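/- Let $X$ be a locally noetherian noncommutative space, i.e. a Grothendieck category (Ab5 abelian category with a generator) having a set of noetherian generators, and suppose that $X$ is affine: there are a ring $R$ (associative, with $1$, necessarily right noetherian) and an equivalence of $X$ with the category $\operatorname{Mod} R$ of right $R$-modules. A full subcategory of $X$, closed under isomorphisms, direct sums and subquotients, is \emph{weakly closed} if its inclusion functor has a right adjoint, and \emph{closed} if its inclusion functor has both a right and a left adjoint. For an object $M$ let $\sigma[M]$ (resp. $\pi[M]$) be the smallest weakly closed (resp. closed) subcategory containing $M$. An object $M$ is \emph{prime} if $\pi[M]=\pi[N]$ for every nonzero subobject $N\le M$. The space $X$ is \emph{reduced} if the smallest closed subcategory containing all prime objects is $X$ itself, and \emph{integral} if $X=\sigma[E]$ for some indecomposable injective object $E$ such that $\operatorname{End}(E)$ is a division ring. Then $X$ is both reduced and integral if and only if $R$ is a prime ring (that is, $R\neq 0$ and $aRb=0$ implies $a=0$ or $b=0$ for all $a,b\in R$). -/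

import Mathlib

open CategoryTheory CategoryTheory.Limits

universe v u

namespace NCSpace

section

variable {C : Type u} [Category.{v} C] [Abelian C]

/-- A weakly closed subspace of the noncommutative space `C`: a full subcategory closed under
isomorphisms, small direct sums, subobjects and quotients, whose inclusion functor has a right
adjoint. (In a Grothendieck category such a full subcategory is again a Grothendieck category:
kernels, cokernels and direct sums are computed in `C`, and the quotients of a generator of `C`
that lie in the subcategory generate it.) -/
structure IsWeaklyClosed (Z : ObjectProperty C) : Prop where
  closedUnderIsomorphisms : Z.IsClosedUnderIsomorphisms
  closedUnderCoproducts : ∀ J : Type v, Z.IsClosedUnderColimitsOfShape (Discrete J)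
  closedUnderSubobjects : Z.IsClosedUnderSubobjects
  closedUnderQuotients : Z.IsClosedUnderQuotients
  hasRightAdjoint : Z.ι.IsLeftAdjoint

/-- A closed subspace: a weakly closed subspace whose inclusion functor also has a left adjoint. -/
structure IsClosed (Z : ObjectProperty C) : Prop extends IsWeaklyClosed Z where
  hasLeftAdjoint : Z.ι.IsRightAdjoint

/-- `σ[M]`, the smallest weakly closed subspace containing the object `M`, as the intersection of
all of them. -/
def sigma (M : C) : ObjectProperty C :=
  fun N => ∀ Z : ObjectProperty C, IsWeaklyClosed Z → Z M → Z N

/-- The smallest closed subspace containing all objects that satisfy `S`, as the intersection of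
all of them. -/
def closedHull (S : ObjectProperty C) : ObjectProperty C :=
  fun N => ∀ Z : ObjectProperty C, IsClosed Z → (∀ M, S M → Z M) → Z N

/-- `π[M]`, the smallest closed subspace containing the object `M`. -/
def piHull (M : C) : ObjectProperty C :=
  closedHull (fun N => N = M)

/-- An object `M` is prime if `π[M] = π[N]` for every nonzero subobject `N` of `M`. (The zero
object, which satisfies this vacuously, lies in every closed subspace.) -/
def IsPrimeObject (M : C) : Prop :=
  ∀ (N : C) (i : N ⟶ M), Mono i → ¬ IsZero N → piHull M = piHull N

variable (C)

/-- The reduced subspace: the smallest closed subspace containing all prime objects. -/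
def reducedSubspace : ObjectProperty C :=
  closedHull (fun M : C => IsPrimeObject M)

/-- The space `C` is reduced if it equals its reduced subspace. -/
def IsReducedSpace : Prop :=
  reducedSubspace C = ⊤

/-- The space `C` is integral if it equals `σ[E]` for some indecomposable injective object `E`
whose endomorphism ring is a division ring. -/
def IsIntegralSpace : Prop :=
  ∃ E : C, Injective E ∧ Indecomposable E ∧
    (Nontrivial (End E) ∧ ∀ f : End E, f ≠ 0 → IsUnit f) ∧ sigma E = ⊤

/-- The space `C` is locally noetherian if it has a (small) set of noetherian generators. -/
def IsLocallyNoetherianSpace : Prop :=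
  ∃ P : ObjectProperty C, ObjectProperty.Small.{v} P ∧
    (∀ M, P M → IsNoetherianObject M) ∧ P.IsSeparating

end

/-- A prime ring: a nonzero ring in which `a R b = 0` implies `a = 0` or `b = 0`. -/
def IsPrimeRing (R : Type*) [Ring R] : Prop :=
  Nontrivial R ∧ ∀ a b : R, (∀ r : R, a * r * b = 0) → a = 0 ∨ b = 0

end NCSpace

/-! Put S = Rᵐᵒᵖ, so that the space is the category of left S-modules and S is left noetherian.
Suppose the space is reduced and aSa = 0. Then a kills every prime object M: if am ≠ 0, the
submodule Sam is killed by a and generates the same closed subspace as M. Hence a kills S, and S is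
semiprime. If the space is σ[E], then S ∈ σ[E] yields a finite subset of E with zero annihilator, so
S embeds in a finite power of E, and E is uniform. Such a semiprime ring is prime
(`Module.eq_zero_or_eq_zero_of_isUniform`): otherwise there are nonzero annihilator ideals A, B with
A ∩ B = 0, neither containing a nonzero left ideal that embeds in E; yet some nonzero left ideal
embeds in E, and missing A forces it into B.

Conversely, let S be prime. Nonzero left ideals are faithful, so S is a prime object, and it
generates everything. For integrality, E is the injective hull of a uniform left ideal U.
Nonsingularity of S makes nonzero endomorphisms of E injective, hence bijective, and a finite subset
of U has zero annihilator, so S embeds in a finite power of E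
(`exists_injective_isUniform_of_prime`). -/

section Algebra

/-! ### Essential extensions inside injective modules. -/

namespace Submodule

/-- Every submodule of an injective module is essential in a direct summand. -/
theorem exists_isCompl_essential {S : Type u} [Ring S] [Small.{v} S]
    {Q : Type v} [AddCommGroup Q] [Module S Q] [Module.Injective S Q] (A : Submodule S Q) :
    ∃ E X : Submodule S Q, IsCompl E X ∧ A ≤ E ∧ ∀ B ≤ E, Disjoint A B → B = ⊥ := by
  obtain ⟨E, hAE, hE⟩ := zorn_le_nonempty₀
    {E : Submodule S Q | A ≤ E ∧ ∀ B ≤ E, Disjoint A B → B = ⊥} (by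
      intro c hc hchain E hE
      refine ⟨sSup c, ⟨(hc hE).1.trans (le_sSup hE), fun B hB hAB => ?_⟩, fun z hz => le_sSup hz⟩
      rw [eq_bot_iff]
      intro b hb
      obtain ⟨F, hF, hbF⟩ := (mem_sSup_of_directed ⟨E, hE⟩ hchain.directedOn).1 (hB hb)
      have := (hc hF).2 (span S {b}) (by simpa using hbF)
        (hAB.mono_right (by simpa using hb))
      simpa using this) A ⟨le_rfl, fun B hB h => by simpa using h.mono_left hB⟩
  obtain ⟨⟨-, hess⟩, hmax⟩ := hE
  obtain ⟨X, -, hX⟩ := zorn_le_nonempty₀ {X : Submodule S Q | Disjoint E X} (by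
      intro c hc hchain X hX
      refine ⟨sSup c, ?_, fun z hz => le_sSup hz⟩
      rw [Set.mem_ofPred_eq, disjoint_def]
      intro x hxE hx
      obtain ⟨F, hF, hxF⟩ := (mem_sSup_of_directed ⟨X, hX⟩ hchain.directedOn).1 hx
      exact disjoint_def.1 (hc hF) x hxE hxF) ⊥ disjoint_bot_right
  obtain ⟨hEX, hXmax⟩ := hX
  have hinj : Function.Injective (X.mkQ ∘ₗ E.subtype) := by
    rw [← LinearMap.ker_eq_bot, eq_bot_iff]
    rintro ⟨e, he⟩ h
    have h' : e ∈ X := by simpa using h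
    simpa using disjoint_def.1 hEX e he h'
  -- Extending the inclusion of E along E → Q/X gives h : Q → Q, the identity on E and zero on X.
  -- Its range is again essential over A, so maximality of E makes h a projection onto E with kernel
  -- X.
  obtain ⟨g, hg⟩ := Module.Injective.extension_property S Q E (Q ⧸ X) _ hinj E.subtype
  set h : Q →ₗ[S] Q := g ∘ₗ X.mkQ with hh
  have hE1 : ∀ e ∈ E, h e = e := fun e he => by
    simpa [hh] using LinearMap.congr_fun hg ⟨e, he⟩
  have hX0 : ∀ x ∈ X, h x = 0 := fun x hx => by
    have : X.mkQ x = 0 := by simpa using hx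
    rw [hh, LinearMap.comp_apply, this, map_zero]
  have hcomap : ∀ B : Submodule S Q, Disjoint E B → B.comap h = X := by
    intro B hB
    refine le_antisymm (hXmax ?_ ?_) ?_
    · refine disjoint_def.2 fun e he heB => disjoint_def.1 hB e he ?_
      simpa [hE1 e he] using heB
    · intro x hx; simp [hX0 x hx]
    · intro x hx; simp [hX0 x hx]
  have hrange : LinearMap.range h ≤ E := by
    refine hmax ⟨hAE.trans fun e he => ⟨e, hE1 e he⟩, fun B hB hAB => ?_⟩
      fun e he => ⟨e, hE1 e he⟩
    have hEB : Disjoint E B := by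
      rw [disjoint_iff]
      exact hess _ inf_le_left (hAB.mono_right inf_le_right)
    rw [eq_bot_iff]
    intro b hb
    obtain ⟨q, rfl⟩ := hB hb
    have : q ∈ X := by rw [← hcomap B hEB]; exact hb
    simp [hX0 q this]
  refine ⟨E, X, ⟨hEX, ?_⟩, hAE, hess⟩
  rw [codisjoint_iff, eq_top_iff]
  intro q _
  have hq : h q ∈ E := hrange ⟨q, rfl⟩
  refine mem_sup.2 ⟨h q, hq, q - h q, ?_, by abel⟩
  rw [← hcomap ⊥ disjoint_bot_right]
  simp [hE1 _ hq]

end Submodule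

/-! ### Uniform modules and semiprime rings. -/

namespace Module

variable {S : Type*} [Ring S]

/-- A module is uniform if any two nonzero submodules intersect. (The zero module is allowed.) -/
def IsUniform (S E : Type*) [Ring S] [AddCommGroup E] [Module S E] : Prop :=
  ∀ A B : Submodule S E, Disjoint A B → A = ⊥ ∨ B = ⊥

theorem IsUniform.exists_smul_eq_smul {E : Type*} [AddCommGroup E] [Module S E]
    (h : IsUniform S E) {x y : E} (hx : x ≠ 0) (hy : y ≠ 0) :
    ∃ r s : S, r • x = s • y ∧ r • x ≠ 0 := by
  by_contra! hrs
  rcases h (S ∙ x) (S ∙ y) (Submodule.disjoint_def.2 fun z hzx hzy => by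
    obtain ⟨r, rfl⟩ := Submodule.mem_span_singleton.1 hzx
    obtain ⟨s, hs⟩ := Submodule.mem_span_singleton.1 hzy
    exact hrs r s hs.symm) with h | h
  · exact hx (by simpa using h)
  · exact hy (by simpa using h)

theorem IsUniform.of_exists_smul_eq_smul {E : Type*} [AddCommGroup E] [Module S E]
    (h : ∀ x y : E, x ≠ 0 → y ≠ 0 → ∃ r s : S, r • x = s • y ∧ r • x ≠ 0) : IsUniform S E := by
  intro A B hAB
  by_contra! hne
  obtain ⟨x, hx, hx0⟩ := Submodule.exists_mem_ne_zero_of_ne_bot hne.1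
  obtain ⟨y, hy, hy0⟩ := Submodule.exists_mem_ne_zero_of_ne_bot hne.2
  obtain ⟨r, s, h1, h2⟩ := h x y hx0 hy0
  exact h2 (Submodule.disjoint_def.1 hAB _ (A.smul_mem r hx) (h1 ▸ B.smul_mem s hy))

/-- In a module with a finite separating set `F` of elements, some nonzero left ideal is mapped
injectively into the module by right multiplication with an element of `F`. -/
theorem exists_ideal_injOn_of_finset {E : Type*} [AddCommGroup E] [Module S E] (F : Finset E)
    (A : Ideal S) (hA : A ≠ ⊥) (hF : ∀ r ∈ A, (∀ e ∈ F, r • e = 0) → r = 0) :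
    ∃ K ≤ A, K ≠ ⊥ ∧ ∃ e ∈ F, ∀ k ∈ K, k • e = 0 → k = 0 := by
  classical
  induction F using Finset.induction_on generalizing A with
  | empty =>
    exact absurd (A.eq_bot_iff.2 fun r hr => hF r hr (by simp)) hA
  | insert e F _ ih =>
    -- Either e alone works on A, or the part of A killed by e is nonzero and still separated by the
    -- remaining elements.
    by_cases h : A ⊓ LinearMap.ker (LinearMap.toSpanSingleton S E e) = ⊥
    · refine ⟨A, le_rfl, hA, e, by simp, fun k hk hke => ?_⟩
      have : k ∈ A ⊓ LinearMap.ker (LinearMap.toSpanSingleton S E e) := ⟨hk, by simpa using hke⟩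
      rwa [h] at this
    · obtain ⟨K, hK, hK0, e', he', hinj⟩ := ih _ h fun r hr hrF => hF r hr.1 fun x hx => by
        rcases Finset.mem_insert.1 hx with rfl | hx
        · simpa using hr.2
        · exact hrF x hx
      exact ⟨K, hK.trans inf_le_left, hK0, e', Finset.mem_insert_of_mem he', hinj⟩

/-- If a semiprime ring embeds into a finite power of a uniform injective module, then a nonzero
left ideal `K` inside a two-sided ideal `A`, mapped injectively into `E`, forces every two-sided
ideal `B` meeting `A` trivially to vanish. -/
theorem eq_zero_of_mem_of_disjoint {E : Type*} [AddCommGroup E] [Module S E]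
    (hE : Baer S E) (hU : IsUniform S E)
    (hS : ∀ a : S, (∀ s, a * s * a = 0) → a = 0) (F : Finset E)
    (hF : ∀ r : S, (∀ e ∈ F, r • e = 0) → r = 0)
    (A B K : Ideal S) (hAr : ∀ x ∈ A, ∀ s, x * s ∈ A)
    (hAB : Disjoint A B) (hKA : K ≤ A) (hK : K ≠ ⊥) (e : E) (he : ∀ k ∈ K, k • e = 0 → k = 0)
    (b : S) (hb : b ∈ B) : b = 0 := by
  by_contra hb0
  obtain ⟨k₀, hk₀, hk₀0⟩ := Submodule.exists_mem_ne_zero_of_ne_bot hK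
  obtain ⟨f, -, hbf⟩ : ∃ f ∈ F, b • f ≠ 0 := by
    by_contra! h
    exact hb0 (hF b h)
  have hAB0 : ∀ x ∈ A, x ∈ B → x = 0 := Submodule.disjoint_def.1 hAB
  -- a map vanishing on `A` and equal to `y ↦ y • f` on `B`
  have hinj : Function.Injective
      ((A.mkQ : S →ₗ[S] S ⧸ A) ∘ₗ (B.subtype : B →ₗ[S] S)) := by
    rw [← LinearMap.ker_eq_bot, eq_bot_iff]
    rintro ⟨y, hy⟩ h
    have h' : y ∈ A := by simpa using h
    simpa using hAB0 y h' hy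
  obtain ⟨g, hg⟩ := hE.extension_property _ hinj
    ((LinearMap.toSpanSingleton S E f) ∘ₗ (B.subtype : B →ₗ[S] S))
  set e' : E := g (A.mkQ 1) with he'
  have hsm : ∀ x : S, x • e' = g (A.mkQ x) := fun x => by
    rw [he', ← map_smul, ← map_smul, smul_eq_mul, mul_one]
  have hA0 : ∀ x ∈ A, x • e' = 0 := fun x hx => by
    have : A.mkQ x = 0 := by simpa using hx
    rw [hsm, this, map_zero]
  have hB : ∀ y ∈ B, y • e' = y • f := fun y hy => by
    rw [hsm]
    simpa using LinearMap.congr_fun hg ⟨y, hy⟩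
  -- A r b ⊆ A ∩ B = 0, so A kills this common multiple. As K embeds through e, Ak = 0, whence kSk =
  -- 0 and k = 0.
  obtain ⟨r, s, hrs, hne⟩ := hU.exists_smul_eq_smul (x := b • e') (y := k₀ • e)
    (by rwa [hB b hb]) (fun h => hk₀0 (he k₀ hk₀ h))
  set k := s * k₀ with hk
  have hkK : k ∈ K := K.mul_mem_left s hk₀
  have hAk : ∀ x ∈ A, x * k = 0 := fun x hx => by
    refine he _ (K.mul_mem_left x hkK) ?_
    have h0 : x * (r * b) = 0 :=
      hAB0 _ (hAr x hx _) (B.mul_mem_left _ (B.mul_mem_left _ hb))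
    rw [mul_smul, hk, mul_smul s, ← hrs, ← mul_smul r, ← mul_smul, h0, zero_smul]
  have hk0 : k = 0 := hS k fun t => hAk _ (hAr k (hKA hkK) t)
  apply hne
  rw [hrs, ← mul_smul, ← hk, hk0, zero_smul]

/-- A semiprime ring that embeds into a finite power of a uniform injective module is prime. -/
theorem eq_zero_or_eq_zero_of_isUniform {E : Type*} [AddCommGroup E] [Module S E]
    (hE : Baer S E) (hU : IsUniform S E)
    (hS : ∀ a : S, (∀ s, a * s * a = 0) → a = 0) (F : Finset E)
    (hF : ∀ r : S, (∀ e ∈ F, r • e = 0) → r = 0) (a b : S) (hab : ∀ r, a * r * b = 0) :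
    a = 0 ∨ b = 0 := by
  by_contra! hne
  have hswap : ∀ x y : S, (∀ s, x * s * y = 0) → ∀ s, y * s * x = 0 := fun x y h s =>
    hS _ fun t => by
      have := h (t * y * s)
      calc y * s * x * t * (y * s * x) = y * s * (x * t * y) * s * x := by noncomm_ring
        _ = 0 := by rw [h t]; simp
  -- A annihilates the ideal generated by a, and B annihilates A. Semiprimeness makes these
  -- relations symmetric, so b ∈ A, a ∈ B and A ∩ B = 0.
  let A : Ideal S :=
    { carrier := {x | ∀ s, x * s * a = 0}
      zero_mem' := by simp
      add_mem' := fun {x y} hx hy s => by simp [add_mul, hx s, hy s]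
      smul_mem' := fun c x hx s => by
        rw [smul_eq_mul, mul_assoc c, mul_assoc c, hx s, mul_zero] }
  let B : Ideal S :=
    { carrier := {y | ∀ x ∈ A, ∀ s, y * s * x = 0}
      zero_mem' := by simp
      add_mem' := fun {x y} hx hy z hz s => by simp [add_mul, hx z hz s, hy z hz s]
      smul_mem' := fun c x hx z hz s => by
        rw [smul_eq_mul, mul_assoc c, mul_assoc c, hx z hz s, mul_zero] }
  have hAr : ∀ x ∈ A, ∀ s, x * s ∈ A := fun x hx s t => by rw [mul_assoc x]; exact hx _
  have hBr : ∀ x ∈ B, ∀ s, x * s ∈ B := fun x hx s z hz t => by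
    rw [mul_assoc x]; exact hx z hz _
  have hAB : Disjoint A B := Submodule.disjoint_def.2 fun x hx hxB => hS x (hxB x hx)
  have hbA : b ∈ A := hswap a b hab
  have haB : a ∈ B := fun x hx => hswap x a hx
  have key : ∀ K : Ideal S, K ≠ ⊥ → ∀ e : E, (∀ k ∈ K, k • e = 0 → k = 0) →
      K ⊓ A = ⊥ ∧ K ⊓ B = ⊥ := by
    refine fun K hK e he => ⟨?_, ?_⟩ <;> by_contra h
    · exact hne.1 (eq_zero_of_mem_of_disjoint hE hU hS F hF A B (K ⊓ A) hAr hAB inf_le_right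
        h e (fun k hk => he k hk.1) a haB)
    · exact hne.2 (eq_zero_of_mem_of_disjoint hE hU hS F hF B A (K ⊓ B) hBr hAB.symm
        inf_le_right h e (fun k hk => he k hk.1) b hbA)
  have htop : (⊤ : Ideal S) ≠ ⊥ := by
    intro h
    apply hne.1
    have : a ∈ (⊤ : Ideal S) := Submodule.mem_top
    rwa [h] at this
  obtain ⟨K, -, hK, e, -, he⟩ := exists_ideal_injOn_of_finset F ⊤ htop fun r _ => hF r
  obtain ⟨h1, h2⟩ := key K hK e he
  apply hK
  have hKB : K ≤ B := fun k hk x hx s => by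
    refine hswap x k (fun t => ?_) s
    have hmem : x * t * k ∈ K ⊓ A := ⟨K.mul_mem_left _ hk, hAr _ (hAr x hx t) k⟩
    rwa [h1] at hmem
  rwa [inf_eq_left.2 hKB] at h2

end Module

end Algebra

/-! ### Prime left noetherian rings and their uniform injectives. -/

section PrimeNoetherian

variable {S : Type u} [Ring S]

/-- A left ideal is essential if it meets every nonzero principal left ideal. -/
def Ideal.IsEssential (I : Ideal S) : Prop :=
  ∀ x : S, x ≠ 0 → ∃ r : S, r * x ∈ I ∧ r * x ≠ 0

/-- If `U` is an essential submodule of `E`, then each element of `E` is driven into `U` by an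
essential left ideal. -/
theorem Ideal.isEssential_comap_toSpanSingleton {E : Type*} [AddCommGroup E] [Module S E]
    (U : Submodule S E) (hU : ∀ x : E, x ≠ 0 → ∃ r : S, r • x ∈ U ∧ r • x ≠ 0) (e : E) :
    Ideal.IsEssential (U.comap (LinearMap.toSpanSingleton S E e)) := by
  intro x hx
  by_cases h : x • e = 0
  · exact ⟨1, by simp [h], by simpa using hx⟩
  · obtain ⟨r, hr, hr0⟩ := hU _ h
    refine ⟨r, by simpa [mul_smul] using hr, fun h0 => hr0 ?_⟩
    rw [← mul_smul, h0, zero_smul]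

/-- The left annihilator of an element. -/
def Ideal.leftAnnihilator (a : S) : Ideal S := LinearMap.ker (LinearMap.toSpanSingleton S S a)

theorem Ideal.mem_leftAnnihilator {a r : S} : r ∈ Ideal.leftAnnihilator a ↔ r * a = 0 := by
  simp [Ideal.leftAnnihilator]

/-- A prime left noetherian ring is left nonsingular. -/
theorem eq_zero_of_isEssential_leftAnnihilator [IsNoetherianRing S]
    (hS : ∀ a b : S, (∀ r, a * r * b = 0) → a = 0 ∨ b = 0) (a : S)
    (ha : (Ideal.leftAnnihilator a).IsEssential) : a = 0 := by
  by_contra ha0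
  obtain ⟨I, ⟨b, hb0, hb, rfl⟩, hmax⟩ := set_has_maximal_iff_noetherian.2
    (inferInstance : IsNoetherian S S)
    {I | ∃ a : S, a ≠ 0 ∧ (Ideal.leftAnnihilator a).IsEssential ∧ Ideal.leftAnnihilator a = I}
    ⟨_, a, ha0, ha, rfl⟩
  refine hb0 ((or_self_iff).1 (hS b b fun c => ?_))
  by_contra hbcb
  have hle : Ideal.leftAnnihilator b ≤ Ideal.leftAnnihilator (b * c * b) := fun r hr => by
    rw [Ideal.mem_leftAnnihilator] at hr ⊢
    rw [← mul_assoc, ← mul_assoc, hr, zero_mul, zero_mul]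
  refine hmax _ ⟨_, hbcb, fun x hx => ?_, rfl⟩ (lt_of_le_of_ne hle fun heq => ?_)
  · obtain ⟨r, hr, hr0⟩ := hb x hx
    exact ⟨r, hle hr, hr0⟩
  -- Essentiality gives r with rb ≠ 0 and rbcb = 0, so the annihilator of bcb is strictly larger
  -- than that of b.
  · obtain ⟨r, hr, hr0⟩ := (Ideal.isEssential_comap_toSpanSingleton (Ideal.leftAnnihilator b)
      (E := S) (fun x hx => hb x hx) c) b hb0
    apply hr0
    have hr' : r * b * c * b = 0 := by
      simpa [Ideal.mem_leftAnnihilator] using hr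
    rw [← Ideal.mem_leftAnnihilator, heq, Ideal.mem_leftAnnihilator]
    simpa [mul_assoc] using hr'

/-- A nonzero left noetherian ring has a uniform left ideal. -/
theorem exists_ideal_isUniform [IsNoetherianRing S] [Nontrivial S] :
    ∃ U : Ideal S, U ≠ ⊥ ∧ ∀ x ∈ U, ∀ y ∈ U, x ≠ 0 → y ≠ 0 →
      ∃ r s : S, r * x = s * y ∧ r * x ≠ 0 := by
  -- If nonzero x, y ∈ U had no nonzero common multiple, X + Sx would still miss Sy, against
  -- maximality of X.
  obtain ⟨X, ⟨U, hU, hXU⟩, hmax⟩ := set_has_maximal_iff_noetherian.2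
    (inferInstance : IsNoetherian S S) {X : Ideal S | ∃ Y : Ideal S, Y ≠ ⊥ ∧ Disjoint X Y}
    ⟨⊥, ⊤, top_ne_bot, disjoint_bot_left⟩
  refine ⟨U, hU, fun x hx y hy hx0 hy0 => ?_⟩
  by_contra! hxy
  refine hmax (X ⊔ Ideal.span {x}) ⟨Ideal.span {y}, by simpa using hy0, ?_⟩
    (lt_of_le_of_ne le_sup_left fun h => hx0 ?_)
  · refine Submodule.disjoint_def.2 fun z hz hzy => ?_
    obtain ⟨a, haX, b, hb, rfl⟩ := Submodule.mem_sup.1 hz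
    obtain ⟨r, rfl⟩ := Ideal.mem_span_singleton'.1 hb
    obtain ⟨s, hs⟩ := Ideal.mem_span_singleton'.1 hzy
    have ha : a = 0 := by
      refine Submodule.disjoint_def.1 hXU a haX ?_
      have : a = s * y - r * x := by rw [hs]; abel
      rw [this]
      exact U.sub_mem (U.mul_mem_left _ hy) (U.mul_mem_left _ hx)
    rw [ha, zero_add] at hs ⊢
    exact hxy r s hs.symm
  · refine Submodule.disjoint_def.1 hXU x ?_ hx
    rw [h]
    exact Submodule.mem_sup_right (Ideal.mem_span_singleton_self x)

/-- In a prime left noetherian ring, finitely many elements of a nonzero left ideal suffice to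
have zero common left annihilator. -/
theorem exists_finset_leftAnnihilator_eq_bot [IsNoetherianRing S]
    (hS : ∀ a b : S, (∀ r, a * r * b = 0) → a = 0 ∨ b = 0) (U : Ideal S) (hU : U ≠ ⊥) :
    ∃ F : Finset S, (∀ u ∈ F, u ∈ U) ∧ ∀ r : S, (∀ u ∈ F, r * u = 0) → r = 0 := by
  classical
  obtain ⟨u₀, hu₀, hu₀0⟩ := Submodule.exists_mem_ne_zero_of_ne_bot hU
  obtain ⟨A, ⟨F, hFU, hAF⟩, hmax⟩ := set_has_maximal_iff_noetherian.2
    (inferInstance : IsNoetherian S S)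
    {A : Ideal S | ∃ F : Finset S, (∀ u ∈ F, u ∈ U) ∧
      ∀ r ∈ A, (∀ u ∈ F, r * u = 0) → r = 0}
    ⟨⊥, ∅, by simp, by simp⟩
  refine ⟨F, hFU, fun k hk => ?_⟩
  by_contra hk0
  obtain ⟨u, hu, hku⟩ : ∃ u ∈ U, k * u ≠ 0 := by
    by_contra! h
    rcases hS k u₀ (fun r => by rw [mul_assoc]; exact h _ (U.mul_mem_left _ hu₀)) with h | h
    exacts [hk0 h, hu₀0 h]
  have hns : ¬ (Ideal.leftAnnihilator (k * u)).IsEssential := fun h =>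
    hku (eq_zero_of_isEssential_leftAnnihilator hS _ h)
  -- Sx avoids the annihilator of ku, so u separates Sxk, which F kills. Thus F ∪ {u} separates the
  -- strictly larger ideal A + Sxk.
  obtain ⟨x, hx0, hx⟩ : ∃ x : S, x ≠ 0 ∧ ∀ r, r * x * (k * u) = 0 → r * x = 0 := by
    unfold Ideal.IsEssential at hns
    push Not at hns
    simpa [Ideal.mem_leftAnnihilator] using hns
  have hFk : ∀ y : S, ∀ w ∈ F, y * k * w = 0 := fun y w hw => by
    rw [mul_assoc, hk w hw, mul_zero]
  refine hmax (A ⊔ Ideal.span {x * k}) ⟨insert u F, ?_, ?_⟩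
    (lt_of_le_of_ne le_sup_left fun h => ?_)
  · simpa using ⟨hu, hFU⟩
  · intro r hr hrF
    obtain ⟨a, haA, b, hb, rfl⟩ := Submodule.mem_sup.1 hr
    obtain ⟨s, rfl⟩ := Ideal.mem_span_singleton'.1 hb
    have hF0 : ∀ w ∈ F, (a + s * (x * k)) * w = 0 := fun w hw =>
      hrF w (Finset.mem_insert_of_mem hw)
    have ha : a = 0 := hAF a haA fun w hw => by
      have := hF0 w hw
      rwa [add_mul, ← mul_assoc s, hFk _ w hw, add_zero] at this
    have h1 := hrF u (Finset.mem_insert_self u F)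
    rw [ha, zero_add] at h1 ⊢
    rw [← mul_assoc, hx s (by simpa [mul_assoc] using h1), zero_mul]
  · have hmem : x * k ∈ A := by
      rw [h]; exact Submodule.mem_sup_right (Ideal.mem_span_singleton_self _)
    have h0 := hAF _ hmem (hFk x)
    apply hx0
    have := hx 1 (by rw [one_mul, ← mul_assoc, h0, zero_mul])
    simpa using this

/-- A prime left noetherian ring embeds into a finite power of a uniform injective module whose
nonzero endomorphisms are bijective. -/
theorem exists_injective_isUniform_of_prime {S : Type v} [Ring S] [IsNoetherianRing S]
    [Nontrivial S] (hS : ∀ a b : S, (∀ r, a * r * b = 0) → a = 0 ∨ b = 0) :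
    ∃ (E : Type v) (_ : AddCommGroup E) (_ : Module S E), Module.Injective S E ∧ Nontrivial E ∧
      Module.IsUniform S E ∧ (∀ f : E →ₗ[S] E, f ≠ 0 → Function.Bijective f) ∧
      ∃ F : Finset E, ∀ r : S, (∀ e ∈ F, r • e = 0) → r = 0 := by
  classical
  obtain ⟨U, hU, hUu⟩ := exists_ideal_isUniform (S := S)
  obtain ⟨F, hFU, hF⟩ := exists_finset_leftAnnihilator_eq_bot hS U hU
  let p := Classical.choice (EnoughInjectives.presentation (ModuleCat.of S U))
  have hp : Function.Injective p.f.hom := (ModuleCat.mono_iff_injective _).1 p.mono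
  have : Module.Injective S p.J :=
    Module.injective_module_of_injective_object S p.J (inj := p.injective)
  -- The injective hull of U, realised as a direct summand of an injective module.
  obtain ⟨E, X, hEX, hAE, hess⟩ := Submodule.exists_isCompl_essential (LinearMap.range p.f.hom)
  have hEinj : Module.Injective S E := by
    refine ⟨fun M N _ _ _ _ f hf g => ?_⟩
    obtain ⟨h, hh⟩ := Module.Injective.out (Q := p.J) f hf (E.subtype ∘ₗ g)
    refine ⟨E.projectionOnto X hEX ∘ₗ h, fun x => ?_⟩
    simp [hh]
  let i : U →ₗ[S] E := LinearMap.codRestrict E p.f.hom fun u => hAE ⟨u, rfl⟩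
  have hi : Function.Injective i := fun x y h => hp (congrArg Subtype.val h)
  have hess' : ∀ x : E, x ≠ 0 → ∃ r : S, r • x ∈ LinearMap.range i ∧ r • x ≠ 0 := by
    rintro ⟨x, hx⟩ hx0
    by_contra! h
    apply hx0
    have := hess (S ∙ x) (by simpa using hx) (Submodule.disjoint_def.2 fun z hz hzx => by
      obtain ⟨u, rfl⟩ := hz
      obtain ⟨r, hr⟩ := Submodule.mem_span_singleton.1 hzx
      rw [← hr]
      exact congrArg Subtype.val (h r ⟨u, Subtype.ext hr.symm⟩))
    ext
    simpa using this
  have huni : Module.IsUniform S E := by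
    refine Module.IsUniform.of_exists_smul_eq_smul fun x y hx hy => ?_
    obtain ⟨r, ⟨u, hu⟩, hr0⟩ := hess' x hx
    obtain ⟨s, ⟨w, hw⟩, hs0⟩ := hess' y hy
    obtain ⟨a, b, hab, h0⟩ := hUu u u.2 w w.2
      (fun h => hr0 (by rw [← hu, show u = 0 from Subtype.ext h, map_zero]))
      (fun h => hs0 (by rw [← hw, show w = 0 from Subtype.ext h, map_zero]))
    refine ⟨a * r, b * s, ?_, ?_⟩
    · rw [mul_smul, mul_smul, ← hu, ← hw, ← map_smul, ← map_smul]
      exact congrArg i (Subtype.ext hab)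
    · rw [mul_smul, ← hu, ← map_smul]
      intro h
      exact h0 (congrArg Subtype.val (hi (h.trans (map_zero i).symm)))
  have hend : ∀ f : E →ₗ[S] E, f ≠ 0 → Function.Injective f := by
    intro f hf
    rw [← LinearMap.ker_eq_bot]
    by_contra hker
    obtain ⟨z, hz, hz0⟩ := Submodule.exists_mem_ne_zero_of_ne_bot hker
    obtain ⟨e, he⟩ : ∃ e, f e ≠ 0 := by
      by_contra! h
      exact hf (LinearMap.ext h)
    obtain ⟨s, ⟨u, hu⟩, hs0⟩ := hess' _ he
    -- A nonzero kernel is essential by uniformity, so u = s f(e) has an essential annihilator and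
    -- vanishes by nonsingularity.
    have hu0 : (u : S) = 0 := by
      refine eq_zero_of_isEssential_leftAnnihilator hS u ?_
      have := Ideal.isEssential_comap_toSpanSingleton (LinearMap.ker f) (fun x hx => by
        obtain ⟨r, t, h1, h2⟩ := huni.exists_smul_eq_smul hx hz0
        exact ⟨r, h1 ▸ Submodule.smul_mem _ t hz, h2⟩) (s • e)
      intro x hx
      obtain ⟨r, hr, hr0⟩ := this x hx
      refine ⟨r, ?_, hr0⟩
      rw [Ideal.mem_leftAnnihilator]
      have h1 : f ((r * x) • s • e) = 0 := by simpa using hr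
      rw [map_smul, map_smul, ← hu, ← map_smul] at h1
      exact congrArg Subtype.val (hi (h1.trans (map_zero i).symm))
    apply hs0
    rw [← hu, show u = 0 from Subtype.ext hu0, map_zero]
  obtain ⟨u₀, hu₀, hu₀0⟩ := Submodule.exists_mem_ne_zero_of_ne_bot hU
  have hnt : Nontrivial E := ⟨i ⟨u₀, hu₀⟩, 0, fun h =>
    hu₀0 (congrArg Subtype.val (hi (h.trans (map_zero i).symm)))⟩
  refine ⟨E, inferInstance, inferInstance, hEinj, hnt, huni, fun f hf => ⟨hend f hf, ?_⟩,
    F.attach.image fun u => i ⟨u.1, hFU u.1 u.2⟩, fun r hr => hF r fun u hu => ?_⟩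
  -- A retraction g of f is itself a nonzero endomorphism, hence injective, so g is also a right
  -- inverse of f.
  · obtain ⟨g, hg⟩ := Module.Injective.out (Q := E) f (hend f hf) LinearMap.id
    have hgi : Function.Injective g := hend g (by
      rintro rfl
      obtain ⟨x, hx⟩ := exists_ne (0 : E)
      exact hx (hg x).symm)
    exact fun y => ⟨g y, hgi (hg (g y))⟩
  · have := hr (i ⟨u, hu |> hFU u⟩) (by
      rw [Finset.mem_image]
      exact ⟨⟨u, hu⟩, by simp, rfl⟩)
    rw [← map_smul] at this
    exact congrArg Subtype.val (hi (this.trans (map_zero i).symm))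

/-- An injective module which is not the direct sum of two nonzero submodules is uniform. -/
theorem Module.IsUniform.of_isCompl {S : Type u} [Ring S] [Small.{v} S] {E : Type v}
    [AddCommGroup E] [Module S E] [Module.Injective S E]
    (h : ∀ A B : Submodule S E, IsCompl A B → A = ⊥ ∨ B = ⊥) : Module.IsUniform S E := by
  intro A B hAB
  obtain ⟨H, X, hHX, hAH, hess⟩ := Submodule.exists_isCompl_essential A
  rcases h H X hHX with rfl | rfl
  · exact Or.inl (le_bot_iff.1 hAH)
  · right
    have hH : H = ⊤ := by simpa using hHX.codisjoint
    exact hess B (by simp [hH]) hAB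

end PrimeNoetherian

/-! ### Adjoints of inclusions as universal arrows. -/

section Adjoints

variable {C : Type*} [Category C]

/-- A right adjoint amounts to a universal arrow into each object; for the module subcategories
below it is a submodule inclusion. -/
theorem CategoryTheory.ObjectProperty.isLeftAdjoint_ι_iff (Z : ObjectProperty C) :
    Z.ι.IsLeftAdjoint ↔ ∀ X : C, ∃ (T : C) (_ : Z T) (i : T ⟶ X),
      ∀ A, Z A → Function.Bijective (fun g : A ⟶ T => g ≫ i) := by
  constructor
  · intro h X
    let adj := Adjunction.ofIsLeftAdjoint Z.ι
    refine ⟨_, (Z.ι.rightAdjoint.obj X).property, adj.counit.app X, fun A hA => ?_⟩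
    have h1 := (adj.homEquiv ⟨A, hA⟩ X).symm.bijective
    have h2 : Function.Bijective
        (fun g : A ⟶ (Z.ι.rightAdjoint.obj X).obj =>
          (ObjectProperty.homMk g : (⟨A, hA⟩ : Z.FullSubcategory) ⟶ Z.ι.rightAdjoint.obj X)) :=
      ⟨fun f g h => congrArg (fun k => k.hom) h, fun f => ⟨f.hom, rfl⟩⟩
    have h3 := h1.comp h2
    have h4 : (fun g : A ⟶ (Z.ι.rightAdjoint.obj X).obj => g ≫ adj.counit.app X) = _ :=
      funext fun g =>
        (adj.homEquiv_counit (X := ⟨A, hA⟩) (g := ObjectProperty.homMk g)).symm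
    exact h4 ▸ h3
  · intro h
    choose T hT i hi using h
    let eq : ∀ (A : Z.FullSubcategory) (X : C),
        (Z.ι.obj A ⟶ X) ≃ (A ⟶ (⟨T X, hT X⟩ : Z.FullSubcategory)) := fun A X =>
      ((Equiv.ofBijective _ (hi X A.obj A.property)).symm).trans
        ⟨fun g => ObjectProperty.homMk g, fun g => g.hom, fun _ => rfl, fun _ => rfl⟩
    have heq : ∀ A X (f : Z.ι.obj A ⟶ X), (eq A X f).hom ≫ i X = f := fun A X f =>
      (Equiv.ofBijective _ (hi X A.obj A.property)).apply_symm_apply f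
    refine ⟨_, ⟨Adjunction.adjunctionOfEquivRight eq fun A' A X f g => ?_⟩⟩
    refine ObjectProperty.hom_ext _ ((hi X A'.obj A'.property).1 ?_)
    simp only [ObjectProperty.FullSubcategory.comp_hom, Category.assoc]
    rw [heq, heq]
    rfl

/-- The dual criterion: the universal arrows are units, such as quotient maps of modules. -/
theorem CategoryTheory.ObjectProperty.isRightAdjoint_ι_iff (Z : ObjectProperty C) :
    Z.ι.IsRightAdjoint ↔ ∀ X : C, ∃ (T : C) (_ : Z T) (i : X ⟶ T),
      ∀ A, Z A → Function.Bijective (fun g : T ⟶ A => i ≫ g) := by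
  constructor
  · intro h X
    let adj := Adjunction.ofIsRightAdjoint Z.ι
    refine ⟨_, (Z.ι.leftAdjoint.obj X).property, adj.unit.app X, fun A hA => ?_⟩
    have h1 := (adj.homEquiv X ⟨A, hA⟩).bijective
    have h2 : Function.Bijective
        (fun g : (Z.ι.leftAdjoint.obj X).obj ⟶ A =>
          (ObjectProperty.homMk g : Z.ι.leftAdjoint.obj X ⟶ (⟨A, hA⟩ : Z.FullSubcategory))) :=
      ⟨fun f g h => congrArg (fun k => k.hom) h, fun f => ⟨f.hom, rfl⟩⟩
    have h3 := h1.comp h2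
    have h4 : (fun g : (Z.ι.leftAdjoint.obj X).obj ⟶ A => adj.unit.app X ≫ g) = _ :=
      funext fun g =>
        (adj.homEquiv_unit (Y := ⟨A, hA⟩) (f := ObjectProperty.homMk g)).symm
    exact h4 ▸ h3
  · intro h
    choose T hT i hi using h
    let eq : ∀ (X : C) (A : Z.FullSubcategory),
        ((⟨T X, hT X⟩ : Z.FullSubcategory) ⟶ A) ≃ (X ⟶ Z.ι.obj A) := fun X A =>
      Equiv.trans ⟨fun g => g.hom, fun g => ObjectProperty.homMk g, fun _ => rfl, fun _ => rfl⟩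
        (Equiv.ofBijective _ (hi X A.obj A.property))
    refine ⟨_, ⟨Adjunction.adjunctionOfEquivLeft eq fun X A A' g h => ?_⟩⟩
    exact (Category.assoc _ _ _).symm

end Adjoints

/-! ### Invariance under equivalence. -/

namespace NCSpace

section Transfer

variable {C D : Type*} [Category.{v} C] [Category.{v} D]

theorem isLeftAdjoint_ι_inverseImage (e : C ≌ D) (Z : ObjectProperty C)
    [Z.IsClosedUnderIsomorphisms] (h : Z.ι.IsLeftAdjoint) :
    (Z.inverseImage e.inverse).ι.IsLeftAdjoint := by
  rw [ObjectProperty.isLeftAdjoint_ι_iff] at h ⊢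
  intro X
  obtain ⟨T, hT, i, hi⟩ := h (e.inverse.obj X)
  refine ⟨e.functor.obj T, Z.prop_of_iso (e.unitIso.app T) hT,
    e.functor.map i ≫ e.counit.app X, fun A hA => ?_⟩
  have h1 := hi _ hA
  constructor
  · intro f g hfg
    have hu : ∀ f : A ⟶ e.functor.obj T,
        e.inverse.map (f ≫ e.functor.map i ≫ e.counit.app X) =
          (e.inverse.map f ≫ e.unitInv.app T) ≫ i := fun f => by simp
    have := congrArg e.inverse.map hfg
    simp only [hu] at this
    have := h1.1 this
    exact e.inverse.map_injective ((cancel_mono (e.unitInv.app T)).1 this)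
  · intro f
    obtain ⟨g, hg⟩ := h1.2 (e.inverse.map f)
    refine ⟨e.counitInv.app A ≫ e.functor.map g, ?_⟩
    dsimp at hg ⊢
    rw [Category.assoc, ← e.functor.map_comp_assoc, hg]
    simp

theorem isRightAdjoint_ι_inverseImage (e : C ≌ D) (Z : ObjectProperty C)
    [Z.IsClosedUnderIsomorphisms] (h : Z.ι.IsRightAdjoint) :
    (Z.inverseImage e.inverse).ι.IsRightAdjoint := by
  rw [ObjectProperty.isRightAdjoint_ι_iff] at h ⊢
  intro X
  obtain ⟨T, hT, i, hi⟩ := h (e.inverse.obj X)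
  refine ⟨e.functor.obj T, Z.prop_of_iso (e.unitIso.app T) hT,
    e.counitInv.app X ≫ e.functor.map i, fun A hA => ?_⟩
  have h1 := hi _ hA
  constructor
  · intro f g hfg
    have hu : ∀ f : e.functor.obj T ⟶ A,
        e.inverse.map ((e.counitInv.app X ≫ e.functor.map i) ≫ f) =
          i ≫ (e.unit.app T ≫ e.inverse.map f) := fun f => by simp
    have := congrArg e.inverse.map hfg
    simp only [hu] at this
    have := h1.1 this
    exact e.inverse.map_injective ((cancel_epi (e.unit.app T)).1 this)
  · intro f
    obtain ⟨g, hg⟩ := h1.2 (e.inverse.map f)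
    refine ⟨e.functor.map g ≫ e.counit.app A, ?_⟩
    dsimp at hg ⊢
    rw [Category.assoc, ← e.functor.map_comp_assoc, hg]
    simp

/-- `piHull` singles out its object by literal equality; invariance comes from closed subspaces
being closed under isomorphism. -/
theorem piHull_eq_of_iso {M N : C} (i : M ≅ N) : piHull M = piHull N := by
  have key : ∀ {M N : C}, (M ≅ N) → piHull M ≤ piHull N := by
    rintro M N i K h Z hZ hM
    have := hZ.closedUnderIsomorphisms
    refine h Z hZ ?_
    rintro _ rfl
    exact Z.prop_of_iso i.symm (hM N rfl)
  exact le_antisymm (key i) (key i.symm)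

variable [Abelian C] [Abelian D]

theorem IsWeaklyClosed.inverseImage (e : C ≌ D) {Z : ObjectProperty C} (h : IsWeaklyClosed Z) :
    IsWeaklyClosed (Z.inverseImage e.inverse) where
  closedUnderIsomorphisms := by
    have := h.closedUnderIsomorphisms
    infer_instance
  closedUnderCoproducts J := by
    have := h.closedUnderCoproducts J
    infer_instance
  closedUnderSubobjects := by
    have := h.closedUnderSubobjects
    infer_instance
  closedUnderQuotients := by
    have := h.closedUnderQuotients
    infer_instance
  hasRightAdjoint := by
    have := h.closedUnderIsomorphisms
    exact isLeftAdjoint_ι_inverseImage e Z h.hasRightAdjoint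

theorem IsClosed.inverseImage (e : C ≌ D) {Z : ObjectProperty C} (h : IsClosed Z) :
    IsClosed (Z.inverseImage e.inverse) where
  toIsWeaklyClosed := h.toIsWeaklyClosed.inverseImage e
  hasLeftAdjoint := by
    have := h.closedUnderIsomorphisms
    exact isRightAdjoint_ι_inverseImage e Z h.hasLeftAdjoint

theorem piHull_functor_obj_iff (e : C ≌ D) (M : C) (K : D) :
    piHull (e.functor.obj M) K ↔ piHull M (e.inverse.obj K) := by
  constructor
  · rintro h Z hZ hM
    have := hZ.closedUnderIsomorphisms
    refine h _ (hZ.inverseImage e) ?_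
    rintro _ rfl
    exact Z.prop_of_iso (e.unitIso.app M) (hM M rfl)
  · rintro h Z hZ hM
    have := hZ.closedUnderIsomorphisms
    refine Z.prop_of_iso (e.counitIso.app K) (h _ (hZ.inverseImage e.symm) ?_)
    rintro _ rfl
    exact hM _ rfl

theorem IsPrimeObject.functor_obj (e : C ≌ D) {M : C} (h : IsPrimeObject M) :
    IsPrimeObject (e.functor.obj M) := by
  intro N i _ hN
  have h1 := h (e.inverse.obj N) (e.inverse.map i ≫ e.unitInv.app M) inferInstance
    fun hz => hN ((e.functor.map_isZero hz).of_iso (e.counitIso.app N).symm)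
  refine Eq.trans ?_ (piHull_eq_of_iso (e.counitIso.app N))
  funext K
  apply propext
  dsimp
  rw [piHull_functor_obj_iff, piHull_functor_obj_iff, h1]

theorem IsReducedSpace.of_equivalence (e : C ≌ D) (h : IsReducedSpace C) : IsReducedSpace D := by
  refine top_le_iff.1 fun N _ Z hZ hM => ?_
  have := hZ.closedUnderIsomorphisms
  have h1 : reducedSubspace C (e.inverse.obj N) := by
    rw [show reducedSubspace C = ⊤ from h]; trivial
  exact Z.prop_of_iso (e.counitIso.app N) (h1 _ (hZ.inverseImage e.symm)
    fun M hMp => hM _ (hMp.functor_obj e))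

theorem indecomposable_functor_obj (e : C ≌ D) {E : C} (h : Indecomposable E) :
    Indecomposable (e.functor.obj E) := by
  refine ⟨fun hz => h.1 ((e.inverse.map_isZero hz).of_iso (e.unitIso.app E)), fun Y Z i => ?_⟩
  have := preservesBinaryBiproduct_of_preservesBinaryProduct e.inverse (X := Y) (Y := Z)
  have hz : ∀ Y : D, IsZero (e.inverse.obj Y) → IsZero Y := fun Y hY =>
    (e.functor.map_isZero hY).of_iso (e.counitIso.app Y).symm
  exact (h.2 _ _ (e.unitIso.app E ≪≫ e.inverse.mapIso i ≪≫ e.inverse.mapBiprod Y Z)).imp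
    (hz Y) (hz Z)

theorem IsIntegralSpace.of_equivalence (e : C ≌ D) (h : IsIntegralSpace C) :
    IsIntegralSpace D := by
  obtain ⟨E, hinj, hind, ⟨hnt, hdiv⟩, hσ⟩ := h
  refine ⟨e.functor.obj E, (e.map_injective_iff E).2 hinj, indecomposable_functor_obj e hind,
    ⟨(e.fullyFaithfulFunctor.mulEquivEnd E).injective.nontrivial, fun f hf => ?_⟩, ?_⟩
  · obtain ⟨g, rfl⟩ := e.functor.map_surjective f
    have hg : g ≠ 0 := by
      rintro rfl
      simp at hf
    exact (hdiv g hg).map (e.fullyFaithfulFunctor.mulEquivEnd E)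
  · refine top_le_iff.1 fun N _ Z hZ hE => ?_
    have := hZ.closedUnderIsomorphisms
    have h1 : sigma E (e.inverse.obj N) := by rw [hσ]; trivial
    exact Z.prop_of_iso (e.counitIso.app N) (h1 _ (hZ.inverseImage e.symm) hE)

end Transfer

end NCSpace

theorem CategoryTheory.IsNoetherianObject.functor_obj {C D : Type*} [Category* C] [Category* D]
    (e : C ≌ D) (M : C) [IsNoetherianObject M] : IsNoetherianObject (e.functor.obj M) := by
  refine (isNoetherianObject.is_iff _).2 ?_
  let φ : Subobject M ≃o Subobject (e.functor.obj M) :=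
    ((MonoOver.congr M e).trans (ThinSkeleton.equivalence _).symm).thinSkeletonOrderIso
  exact φ.symm.strictMono.wellFoundedGT

/-! ### Weakly closed and closed subcategories of modules. -/

namespace ModuleCat

variable {S : Type v} [Ring S]

/-- A submodule of a colimit containing the images of all components is everything. -/
theorem eq_top_of_isColimit {J : Type*} [Category* J] {F : J ⥤ ModuleCat.{v} S}
    {c : Cocone F} (hc : IsColimit c) (W : Submodule S c.pt)
    (hW : ∀ (j : J) (x : F.obj j), (c.ι.app j).hom x ∈ W) : W = ⊤ := by
  have h : ofHom W.mkQ = 0 := by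
    refine hc.hom_ext fun j => ?_
    ext x
    simpa using hW j x
  rw [← Submodule.ker_mkQ W, LinearMap.ker_eq_top]
  exact congrArg Hom.hom h

/-- A property of modules given by an elementwise condition `p` that cuts out submodules and is
compatible with linear maps defines a weakly closed subspace. -/
theorem isWeaklyClosed_of_forall_mem
    (p : ∀ N : ModuleCat.{v} S, Submodule S N)
    (hp : ∀ (N N' : ModuleCat.{v} S) (f : N ⟶ N') (x : N), x ∈ p N → f.hom x ∈ p N')
    (hinj : ∀ (N N' : ModuleCat.{v} S) (f : N ⟶ N') [Mono f] (x : N), f.hom x ∈ p N' → x ∈ p N) :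
    NCSpace.IsWeaklyClosed (fun N : ModuleCat.{v} S => p N = ⊤) := by
  have hsub : ObjectProperty.IsClosedUnderSubobjects
      (fun N : ModuleCat.{v} S => p N = ⊤) := ⟨fun {X Y} f _ hY =>
    top_le_iff.1 fun x _ => hinj _ _ f x (by
      rw [show p Y = ⊤ from hY]; trivial)⟩
  have hquot : ObjectProperty.IsClosedUnderQuotients
      (fun N : ModuleCat.{v} S => p N = ⊤) := ⟨fun {X Y} f _ hX =>
    top_le_iff.1 fun y _ => by
      obtain ⟨x, rfl⟩ := (epi_iff_surjective f).1 inferInstance y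
      exact hp _ _ f x (by rw [show p X = ⊤ from hX]; trivial)⟩
  refine ⟨inferInstance, fun J => ⟨?_⟩, hsub, hquot, ?_⟩
  · rintro X ⟨⟨⟨F, ι, hc⟩, hF⟩⟩
    refine eq_top_of_isColimit hc _ fun j x => ?_
    refine hp _ _ (ι.app j) x ?_
    rw [show p (F.obj j) = ⊤ from hF j]
    trivial
  · rw [ObjectProperty.isLeftAdjoint_ι_iff]
    intro X
    have hmono : Mono (ofHom (p X).subtype) :=
      (mono_iff_injective _).2 (Submodule.injective_subtype _)
    refine ⟨of S (p X), ?_, ofHom (p X).subtype, fun A hA => ⟨fun f g h => ?_, fun f => ?_⟩⟩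
    · exact top_le_iff.1 fun x _ => hinj _ _ (ofHom (p X).subtype) x x.2
    · exact (cancel_mono _).1 h
    · refine ⟨ofHom (LinearMap.codRestrict (p X) f.hom fun x => hp _ _ f x ?_), rfl⟩
      rw [show p A = ⊤ from hA]
      trivial

/-- The modules annihilated by a fixed set of scalars form a closed subspace. -/
theorem isClosed_annihilated (I : Set S) :
    NCSpace.IsClosed (fun N : ModuleCat.{v} S => ∀ a ∈ I, ∀ x : N, a • x = 0) := by
  -- I need not be an ideal; the extra scalar s makes the condition cut out a submodule.
  let p : ∀ N : ModuleCat.{v} S, Submodule S N := fun N =>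
    { carrier := {x | ∀ a ∈ I, ∀ s : S, a • s • x = 0}
      zero_mem' := by simp
      add_mem' := fun {x y} hx hy a ha s => by simp [hx a ha s, hy a ha s]
      smul_mem' := fun c x hx a ha s => by rw [← mul_smul s]; exact hx a ha _ }
  have heq : (fun N : ModuleCat.{v} S => ∀ a ∈ I, ∀ x : N, a • x = 0) = fun N => p N = ⊤ := by
    funext N
    refine propext ⟨fun h => top_le_iff.1 fun x _ a ha s => h a ha _, fun h a ha x => ?_⟩
    have hx : x ∈ p N := h ▸ Submodule.mem_top
    simpa using hx a ha 1
  refine ⟨?_, ?_⟩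
  · rw [heq]
    refine isWeaklyClosed_of_forall_mem p (fun N N' f x hx a ha s => ?_)
      fun N N' f _ x hx a ha s => (mono_iff_injective f).1 inferInstance ?_
    · rw [← map_smul, ← map_smul, hx a ha s, map_zero]
    · have := hx a ha s
      rw [← map_smul, ← map_smul] at this
      exact this.trans (map_zero _).symm
  · rw [ObjectProperty.isRightAdjoint_ι_iff]
    intro X
    -- The reflection of X is its quotient by the submodule generated by IX.
    let K : Submodule S X := Submodule.span S {y | ∃ a ∈ I, ∃ x : X, a • x = y}
    have hepi : Epi (ofHom K.mkQ) := (epi_iff_surjective _).2 K.mkQ_surjective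
    refine ⟨of S (X ⧸ K), fun a ha x => ?_, ofHom K.mkQ,
      fun A hA => ⟨fun f g h => (cancel_epi _).1 h, fun f => ?_⟩⟩
    · obtain ⟨x, rfl⟩ := K.mkQ_surjective x
      rw [← map_smul, Submodule.mkQ_apply, Submodule.Quotient.mk_eq_zero]
      exact Submodule.subset_span ⟨a, ha, x, rfl⟩
    · refine ⟨ofHom (K.liftQ f.hom (Submodule.span_le.2 ?_)), ?_⟩
      · rintro _ ⟨a, ha, x, rfl⟩
        simpa using hA a ha _
      · ext x
        simp

/-- The modules all of whose elements have an annihilator containing the annihilator of some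
finite subset of `E` form a weakly closed subspace. -/
theorem isWeaklyClosed_finitelyAnnihilated (E : Type v) [AddCommGroup E] [Module S E] :
    NCSpace.IsWeaklyClosed (fun N : ModuleCat.{v} S =>
      ∀ x : N, ∃ F : Finset E, ∀ r : S, (∀ e ∈ F, r • e = 0) → r • x = 0) := by
  classical
  let p : ∀ N : ModuleCat.{v} S, Submodule S N := fun N =>
    { carrier := {x | ∃ F : Finset E, ∀ r : S, (∀ e ∈ F, r • e = 0) → r • x = 0}
      zero_mem' := ⟨∅, by simp⟩
      add_mem' := by
        rintro x y ⟨F, hF⟩ ⟨G, hG⟩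
        refine ⟨F ∪ G, fun r hr => ?_⟩
        rw [smul_add, hF r fun e he => hr e (Finset.mem_union_left _ he),
          hG r fun e he => hr e (Finset.mem_union_right _ he), add_zero]
      smul_mem' := by
        rintro c x ⟨F, hF⟩
        -- If r kills cF, then rc kills F and hence x.
        refine ⟨F.image (c • ·), fun r hr => ?_⟩
        rw [← mul_smul]
        refine hF _ fun e he => ?_
        rw [mul_smul]
        exact hr _ (Finset.mem_image_of_mem _ he) }
  have heq : (fun N : ModuleCat.{v} S =>
      ∀ x : N, ∃ F : Finset E, ∀ r : S, (∀ e ∈ F, r • e = 0) → r • x = 0) = fun N => p N = ⊤ := by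
    funext N
    exact propext (Submodule.eq_top_iff' (p := p N)).symm
  rw [heq]
  refine isWeaklyClosed_of_forall_mem p ?_ ?_
  · rintro N N' f x ⟨F, hF⟩
    exact ⟨F, fun r hr => by rw [← map_smul, hF r hr, map_zero]⟩
  · rintro N N' f _ x ⟨F, hF⟩
    refine ⟨F, fun r hr => (mono_iff_injective f).1 inferInstance ?_⟩
    have := hF r hr
    rw [← map_smul] at this
    exact this.trans (map_zero _).symm

/-- A weakly closed subspace containing the ring itself is everything. -/
theorem eq_top_of_isWeaklyClosed {Z : ObjectProperty (ModuleCat.{v} S)}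
    (hZ : NCSpace.IsWeaklyClosed Z) (h : Z (of S S)) (N : ModuleCat.{v} S) : Z N := by
  have := hZ.closedUnderCoproducts N
  have := hZ.closedUnderQuotients
  let f : (∐ fun _ : N => of S S) ⟶ N :=
    Sigma.desc fun x : N => ofHom (LinearMap.toSpanSingleton S N x)
  have hf : Epi f := by
    rw [epi_iff_surjective]
    intro x
    refine ⟨(Sigma.ι (fun _ : N => of S S) x).hom (1 : S), ?_⟩
    have : Sigma.ι (fun _ : N => of S S) x ≫ f = _ := Sigma.ι_desc _ _
    have h2 := congrArg (fun g => g.hom (1 : S)) this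
    simpa using h2
  exact Z.prop_of_epi f (Z.prop_colimit _ fun _ => h)

/-- A closed subspace containing a faithful module is everything. -/
theorem eq_top_of_isClosed_of_faithful {Z : ObjectProperty (ModuleCat.{v} S)}
    (hZ : NCSpace.IsClosed Z) {M : ModuleCat.{v} S} (hM : Z M)
    (hfaith : ∀ r : S, (∀ x : M, r • x = 0) → r = 0) (N : ModuleCat.{v} S) : Z N := by
  refine eq_top_of_isWeaklyClosed hZ.toIsWeaklyClosed ?_ N
  have := hZ.closedUnderSubobjects
  obtain ⟨T, hT, i, hi⟩ := (ObjectProperty.isRightAdjoint_ι_iff Z).1 hZ.hasLeftAdjoint (of S S)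
  -- Every map 1 ↦ x from S to M factors through the reflection i, so the kernel of i annihilates
  -- the faithful module M.
  have hmono : Mono i := by
    rw [mono_iff_injective, ← LinearMap.ker_eq_bot, eq_bot_iff]
    intro r hr
    refine hfaith r fun x => ?_
    obtain ⟨g, hg⟩ := (hi M hM).2 (ofHom (LinearMap.toSpanSingleton S M x))
    have h1 : (i ≫ g).hom r = r • x := by
      rw [show i ≫ g = _ from hg]; simp
    rw [← h1, hom_comp, LinearMap.comp_apply, show i.hom r = 0 from hr, map_zero]
  exact Z.prop_of_mono i hT

/-- A weakly closed subspace containing a module that has a finite subset with zero annihilator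
is everything. -/
theorem eq_top_of_isWeaklyClosed_of_finset {Z : ObjectProperty (ModuleCat.{v} S)}
    (hZ : NCSpace.IsWeaklyClosed Z) {E : ModuleCat.{v} S} (hE : Z E) (F : Finset E)
    (hF : ∀ r : S, (∀ e ∈ F, r • e = 0) → r = 0) (N : ModuleCat.{v} S) : Z N := by
  refine eq_top_of_isWeaklyClosed hZ ?_ N
  have := hZ.closedUnderSubobjects
  have := hZ.closedUnderCoproducts F
  let f : of S S ⟶ ⨁ fun _ : F => E :=
    biproduct.lift fun e => ofHom (LinearMap.toSpanSingleton S E e.1)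
  have hf : Mono f := by
    rw [mono_iff_injective, ← LinearMap.ker_eq_bot, eq_bot_iff]
    intro r hr
    refine hF r fun e he => ?_
    have h1 : (f ≫ biproduct.π (fun _ : F => E) ⟨e, he⟩).hom r = r • e := by
      rw [biproduct.lift_π]; simp
    rw [← h1, hom_comp, LinearMap.comp_apply, show f.hom r = 0 from hr, map_zero]
  exact Z.prop_of_mono f (Z.prop_of_isColimit (biproduct.isColimit _) fun _ => hE)

end ModuleCat

/-! ### Reduced and integral module categories. -/

namespace ModuleCat

variable {S : Type v} [Ring S]

/-- An element `a` with `a S a = 0` annihilates all prime objects. -/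
theorem smul_eq_zero_of_isPrimeObject {M : ModuleCat.{v} S} (hM : NCSpace.IsPrimeObject M) {a : S}
    (ha : ∀ s, a * s * a = 0) (m : M) : a • m = 0 := by
  by_contra h
  let N : Submodule S M := S ∙ (a • m)
  have hN0 : ¬ IsZero (of S N) := fun hz => by
    have := subsingleton_of_isZero hz
    have h1 : (⟨a • m, Submodule.mem_span_singleton_self _⟩ : N) = 0 :=
      Subsingleton.elim (α := of S N) _ _
    exact h (congrArg Subtype.val h1)
  have hpi := hM (of S N) (ofHom N.subtype)
    ((mono_iff_injective _).2 N.injective_subtype) hN0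
  have hMM : NCSpace.piHull M M := fun Z _ hZ => hZ M rfl
  rw [hpi] at hMM
  -- The modules killed by a form a closed subspace containing N = Sam, hence also M.
  refine h (hMM _ (isClosed_annihilated {a}) ?_ a rfl m)
  rintro _ rfl b rfl ⟨x, hx⟩
  obtain ⟨s, rfl⟩ := Submodule.mem_span_singleton.1 hx
  refine Subtype.ext ?_
  change b • s • b • m = 0
  rw [← mul_smul, ← mul_smul, ha, zero_smul]

/-- The closed subspace of modules killed by a contains all prime objects, hence S itself. -/
theorem eq_zero_of_isReducedSpace (h : NCSpace.IsReducedSpace (ModuleCat.{v} S)) {a : S}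
    (ha : ∀ s, a * s * a = 0) : a = 0 := by
  have h1 : NCSpace.reducedSubspace (ModuleCat.{v} S) (of S S) := by
    rw [show NCSpace.reducedSubspace (ModuleCat.{v} S) = ⊤ from h]; trivial
  have h2 : a • (1 : S) = 0 := h1 _ (isClosed_annihilated {a}) (by
    rintro M hM b rfl x
    exact smul_eq_zero_of_isPrimeObject hM ha x) a rfl 1
  simpa using h2

/-- The module category of a prime ring is reduced. -/
theorem isReducedSpace_of_prime (hS : ∀ a b : S, (∀ r, a * r * b = 0) → a = 0 ∨ b = 0) :
    NCSpace.IsReducedSpace (ModuleCat.{v} S) := by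
  have hprime : NCSpace.IsPrimeObject (of S S) := by
    intro N i _ hN
    obtain ⟨x, hx⟩ : ∃ x : N, x ≠ 0 := by
      by_contra! h
      have : Subsingleton N := ⟨fun x y => (h x).trans (h y).symm⟩
      exact hN (isZero_of_subsingleton N)
    have hi := (mono_iff_injective i).1 inferInstance
    have hix : i.hom x ≠ 0 := fun h => hx (hi (h.trans (map_zero _).symm))
    have hfaith : ∀ r : S, (∀ y : N, r • y = 0) → r = 0 := fun r hr =>
      (hS r (i.hom x) fun s => by
        have h1 : i.hom (r • s • x) = 0 := by rw [hr, map_zero]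
        rw [map_smul, map_smul, smul_eq_mul, smul_eq_mul, ← mul_assoc] at h1
        exact h1).resolve_right hix
    have h1 : NCSpace.piHull (of S S) = ⊤ := top_le_iff.1 fun K _ Z hZ hM =>
      eq_top_of_isWeaklyClosed hZ.toIsWeaklyClosed (hM _ rfl) K
    have h2 : NCSpace.piHull N = ⊤ := top_le_iff.1 fun K _ Z hZ hM =>
      eq_top_of_isClosed_of_faithful hZ (hM _ rfl) hfaith K
    rw [h1, h2]
  exact top_le_iff.1 fun K _ Z hZ hM =>
    eq_top_of_isWeaklyClosed hZ.toIsWeaklyClosed (hM _ hprime) K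

theorem isUniform_of_indecomposable {E : ModuleCat.{v} S} (hinj : Injective E)
    (h : Indecomposable E) : Module.IsUniform S E := by
  have : Module.Injective S E := Module.injective_module_of_injective_object S E (inj := hinj)
  refine Module.IsUniform.of_isCompl fun A B hAB => ?_
  have hz : ∀ A : Submodule S E, IsZero (of S A) → A = ⊥ := fun A hA => by
    have : Subsingleton A := subsingleton_of_isZero hA
    exact Submodule.subsingleton_iff_eq_bot.1 this
  exact (h.2 (of S A) (of S B) ((Submodule.prodEquivOfIsCompl A B hAB).symm.toModuleIso ≪≫
    (biprodIsoProd (of S A) (of S B)).symm)).imp (hz A) (hz B)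

theorem indecomposable_of_isUniform {E : ModuleCat.{v} S} [Nontrivial E]
    (h : Module.IsUniform S E) : Indecomposable E := by
  refine ⟨fun hz => not_subsingleton E (subsingleton_of_isZero hz), fun Y Z i => ?_⟩
  let f : Y ⟶ E := biprod.inl ≫ i.inv
  let g : Z ⟶ E := biprod.inr ≫ i.inv
  have hdis : Disjoint (LinearMap.range f.hom) (LinearMap.range g.hom) := by
    rw [Submodule.disjoint_def]
    rintro _ ⟨y, rfl⟩ ⟨z, hz⟩
    have h1 : f ≫ i.hom ≫ biprod.fst = 𝟙 Y := by simp [f]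
    have h2 : g ≫ i.hom ≫ biprod.fst = 0 := by simp [g]
    have h3 : (i.hom ≫ biprod.fst).hom (f.hom y) = y := congrArg (fun k => k.hom y) h1
    have h4 : (i.hom ≫ biprod.fst).hom (g.hom z) = 0 := congrArg (fun k => k.hom z) h2
    rw [hz, h3] at h4
    rw [h4, map_zero]
  have key : ∀ {Y : ModuleCat.{v} S} (f : Y ⟶ E) [Mono f], LinearMap.range f.hom = ⊥ →
      IsZero Y := fun f _ h => by
    rw [LinearMap.range_eq_bot] at h
    exact IsZero.of_mono_eq_zero f (hom_ext h)
  exact (h _ _ hdis).imp (key f) (key g)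

/-- If the module category of a ring is reduced and integral, the ring is prime. -/
theorem isPrimeRing_of_isReducedSpace_of_isIntegralSpace
    (hred : NCSpace.IsReducedSpace (ModuleCat.{v} S))
    (hint : NCSpace.IsIntegralSpace (ModuleCat.{v} S)) : NCSpace.IsPrimeRing S := by
  obtain ⟨E, hinj, hind, -, hσ⟩ := hint
  have : Module.Injective S E := Module.injective_module_of_injective_object S E (inj := hinj)
  have h1 : NCSpace.sigma E (of S S) := by rw [hσ]; trivial
  -- Testing S ∈ σ[E] on the element 1 produces the finite set with zero annihilator.
  obtain ⟨F, hF⟩ := h1 _ (isWeaklyClosed_finitelyAnnihilated E)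
    (fun x => ⟨{x}, fun r hr => hr x (Finset.mem_singleton_self x)⟩) (1 : S)
  refine ⟨?_, fun a b => Module.eq_zero_or_eq_zero_of_isUniform (Module.Baer.of_injective this)
    (isUniform_of_indecomposable hinj hind) (fun a => eq_zero_of_isReducedSpace hred) F
    (fun r hr => by simpa using hF r hr) a b⟩
  by_contra hnt
  rw [not_nontrivial_iff_subsingleton] at hnt
  have : Subsingleton E := Module.subsingleton S E
  exact hind.1 (isZero_of_subsingleton E)

/-- The module category of a prime left noetherian ring is integral. -/
theorem isIntegralSpace_of_prime [IsNoetherianRing S] [Nontrivial S]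
    (hS : ∀ a b : S, (∀ r, a * r * b = 0) → a = 0 ∨ b = 0) :
    NCSpace.IsIntegralSpace (ModuleCat.{v} S) := by
  obtain ⟨E, _, _, hinj, hnt, huni, hend, F, hF⟩ := exists_injective_isUniform_of_prime hS
  have hnt' : Nontrivial (of S E) := hnt
  refine ⟨of S E, Module.injective_object_of_injective_module S E,
    indecomposable_of_isUniform huni, ⟨⟨𝟙 _, 0, fun h => ?_⟩, fun f hf => ?_⟩, ?_⟩
  · exact not_subsingleton E (subsingleton_of_isZero ((IsZero.iff_id_eq_zero (of S E)).2 h))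
  · have hb := hend f.hom fun h => hf (hom_ext h)
    have : IsIso (show of S E ⟶ of S E from f) := (ConcreteCategory.isIso_iff_bijective _).2 hb
    exact (isUnit_iff_isIso _).2 this
  · exact top_le_iff.1 fun N _ Z hZ hE => eq_top_of_isWeaklyClosed_of_finset hZ hE F hF N

end ModuleCat

/-! ### Noetherianity, the opposite ring and the conclusion. -/

theorem isSeparating_functor_obj {C D : Type*} [Category* C] [Category* D] (e : C ≌ D)
    {P : ObjectProperty C} (hP : P.IsSeparating) {X Y : D} (f g : X ⟶ Y)
    (h : ∀ G, P G → ∀ h : e.functor.obj G ⟶ X, h ≫ f = h ≫ g) : f = g := by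
  refine e.inverse.map_injective (hP _ _ fun G hG k => e.functor.map_injective ?_)
  rw [← cancel_mono (e.counit.app _)]
  simpa using h G hG (e.functor.map k ≫ e.counit.app _)

/-- A ring whose module category is locally noetherian is noetherian. -/
theorem isNoetherianRing_of_isLocallyNoetherianSpace {C : Type u} [Category.{v} C] [Abelian C]
    (hC : NCSpace.IsLocallyNoetherianSpace C) {S : Type v} [Ring S]
    (e : C ≌ ModuleCat.{v} S) : IsNoetherianRing S := by
  obtain ⟨P, -, hP, hsep⟩ := hC
  let c : Set (Submodule S S) := {L | IsNoetherian S L}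
  have hdir : DirectedOn (· ≤ ·) c := fun L hL L' hL' => by
    have : IsNoetherian S L := hL
    have : IsNoetherian S L' := hL'
    exact ⟨L ⊔ L', isNoetherian_sup L L', le_sup_left, le_sup_right⟩
  have hbot : IsNoetherian S (⊥ : Submodule S S) := inferInstance
  -- Images of noetherian generators are noetherian left ideals, so these fill S; directedness then
  -- puts 1 in a single one.
  have hW : sSup c = ⊤ := by
    have h0 : ModuleCat.ofHom (sSup c).mkQ = 0 := by
      refine isSeparating_functor_obj e hsep _ _ fun G hG h => ?_
      have := hP G hG
      have hGn := IsNoetherianObject.functor_obj e G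
      have hn : IsNoetherian S (e.functor.obj G) := by
        rw [isNoetherian_iff']
        exact (ModuleCat.subobjectModule (e.functor.obj G)).symm.strictMono.wellFoundedGT
      ext x
      have hx : h.hom x ∈ sSup c :=
        le_sSup (a := LinearMap.range h.hom)
          (isNoetherian_of_surjective h.hom.rangeRestrict (LinearMap.range_rangeRestrict _))
          ⟨x, rfl⟩
      simpa using hx
    rw [← Submodule.ker_mkQ (sSup c), LinearMap.ker_eq_top]
    exact congrArg ModuleCat.Hom.hom h0
  obtain ⟨L, hL, h1⟩ := (Submodule.mem_sSup_of_directed ⟨⊥, hbot⟩ hdir).1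
    (show (1 : S) ∈ sSup c by rw [hW]; trivial)
  have hLtop : L = ⊤ := (Ideal.eq_top_iff_one L).2 h1
  subst hLtop
  exact isNoetherian_top_iff.1 hL

theorem NCSpace.isPrimeRing_mulOpposite_iff {R : Type*} [Ring R] :
    NCSpace.IsPrimeRing Rᵐᵒᵖ ↔ NCSpace.IsPrimeRing R := by
  refine and_congr MulOpposite.opEquiv.nontrivial_congr.symm
    ⟨fun h a b hab => ?_, fun h a b hab => ?_⟩
  · refine (h (.op b) (.op a) fun r => MulOpposite.unop_injective ?_).symm.imp
      (MulOpposite.op_eq_zero_iff _).1 (MulOpposite.op_eq_zero_iff _).1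
    simpa [mul_assoc] using hab r.unop
  · refine (h b.unop a.unop fun r => MulOpposite.op_injective ?_).symm.imp
      (MulOpposite.unop_eq_zero_iff _).1 (MulOpposite.unop_eq_zero_iff _).1
    simpa [mul_assoc] using hab (.op r)

theorem mainTheorem8 (C : Type u) [Category.{v} C] [Abelian C]
    [IsGrothendieckAbelian.{v} C] (hC : NCSpace.IsLocallyNoetherianSpace C)
    (R : Type v) [Ring R] (e : C ≌ ModuleCat.{v} Rᵐᵒᵖ) :
    (NCSpace.IsReducedSpace C ∧ NCSpace.IsIntegralSpace C) ↔ NCSpace.IsPrimeRing R := by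
  rw [← NCSpace.isPrimeRing_mulOpposite_iff]
  constructor
  · rintro ⟨hred, hint⟩
    exact ModuleCat.isPrimeRing_of_isReducedSpace_of_isIntegralSpace (hred.of_equivalence e)
      (hint.of_equivalence e)
  · rintro ⟨_, hprime⟩
    have := isNoetherianRing_of_isLocallyNoetherianSpace hC e
    exact ⟨(ModuleCat.isReducedSpace_of_prime hprime).of_equivalence e.symm,
      (ModuleCat.isIntegralSpace_of_prime hprime).of_equivalence e.symm⟩
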